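/- Let $D\subset\mathbb{R}^n$ be open with $0\in D$, let $F\in C^2(D;\mathbb{R}^n)$ with $F(0)=0$, and let $A=DF|_0$. Let $S^t$ be the (local) flow of $\dot x=F(x)$ in $D$, where $S^tx$ is defined for $t$ in the maximal interval of existence $J_x\ni 0$ of the solution in $D$ starting at $x$. Assume that $0$ is hyperbolic, i.e. all eigenvalues of $A$ have non-zero real part, and that $A$ is diagonalizable over $\mathbb{C}$: $V^{-1}AV=\operatorname{diag}(\lambda_1,\dots,\lambda_n)$ with $V\in GL_n(\mathbb{C})$ (for instance, $A$ has distinct real eigenvalues). Let $\tilde h:\mathcal N\to\mathcal V$ be a homeomorphism (for instance a $C^1$-diffeomorphism) of an open neighbourhood $\mathcal N\subset D$ of $0$ onto an open set $\mathcal V\ni 0$ such that every $x\in\mathcal N$ has an open interval $I(x)\ni 0$ with $S^tx\in\mathcal N$ and $\tilde h(S^tx)=e^{At}\tilde h(x)$ for all $t\in I(x)$, and put $k=V^{-1}\tilde h=(k_1,\dots,k_n):\mathcal N\to\mathbb{C}^n$. Let $U\subset\mathcal N$ be open and connected with $0\in U$, and assume that no orbit returns to $U$ after leaving it: for every $z\in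 D$ the set $T_z=\{t\in J_z: S^tz\in U\}$ is an interval (possibly empty). Let $$P=\{z\in D:\ T_z\neq\emptyset\},\qquad t(z)=\begin{cases}\inf\,(T_z\cap[0,\infty)) & \text{if } T_z\cap[0,\infty)\ne\emptyset,\\ \sup\,(T_z\cap(-\infty,0)) & \text{otherwise,}\end{cases}\qquad z\in P,$$ so that $t(z)=0$ on $U$, and otherwise $t(z)$ is the time at which the orbit of $z$ enters $U$, forward or, failing that, backward in time. A function $\phi:X\to\mathbb{C}$ on $X\subset D$ satisfies the eigenfunction equation on $X$ with eigenvalue $\lambda$ if, for every $x\in X$, the largest interval $I_x\ni 0$ of times $\tau\in J_x$ with $S^\tau x\in X$ is open and $\phi(S^\tau x)=e^{\lambda\tau}\phi(x)$ for all $\tau\in I_x$. Call $X$ invariant if every orbit starting in $X$ exists and stays in $X$ for all $\tau\in\mathbb{R}$. Such a $\phi$ is an open eigenfunction if $X$ is not invariant, a subdomain eigenfunction if $X$ is invariant and $X\ne D$, and an ordinary eigenfunction if $X=D$ is invariant. Then $U\subset P$, and each $k_j|_U$ extends to a continuous function $s_j:P\to\mathbb{C}$ given by $$s_j(z)=e^{-\lambda_jt(z)}\,k_j\big(S^{t(z)}z\big),\qquad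 z\in P,$$ where, at an entry point $S^{t(z)}z\in\partial U$ outside $\mathcal N$, the value of $k_j$ is understood as the limit of $k_j(S^\tau z)$ as $\tau\to t(z)$, $\tau\in T_z$; this limit always exists, and the formula holds literally whenever $S^{t(z)}z\in\mathcal N$ (in particular for all $z\in P$ if $\overline U\cap D\subset\mathcal N$). Moreover $I_z=J_z$ for every $z\in P$, and $s_j$ satisfies the eigenfunction equation on $P$ with eigenvalue $\lambda_j$. Thus $s_j$ is an open eigenfunction on $P$ if $P$ is not invariant, a subdomain eigenfunction if $P$ is invariant and $P\neq D$, and an ordinary eigenfunction if $P=D$ is invariant. -/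

import Mathlib

open Set Filter Topology

noncomputable section

/-- The state space `ℝⁿ` with its Euclidean norm. -/
abbrev Rn (n : ℕ) : Type := EuclideanSpace ℝ (Fin n)

/-- `γ` solves `γ' = F(γ)`, `γ 0 = x`, inside `D`, on the open interval `I ∋ 0`. -/
def SolvesOn {n : ℕ} (F : Rn n → Rn n) (D : Set (Rn n)) (x : Rn n) (I : Set ℝ)
    (γ : ℝ → Rn n) : Prop :=
  IsOpen I ∧ I.OrdConnected ∧ (0 : ℝ) ∈ I ∧ γ 0 = x ∧
    ∀ t ∈ I, γ t ∈ D ∧ HasDerivAt γ (F (γ t)) t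

/-- The maximal interval of existence, inside `D`, of the solution starting at `x`. -/
def lifetime {n : ℕ} (F : Rn n → Rn n) (D : Set (Rn n)) (x : Rn n) : Set ℝ :=
  {t | ∃ (I : Set ℝ) (γ : ℝ → Rn n), t ∈ I ∧ SolvesOn F D x I γ}

open Classical in
/-- The flow `S^t x` of `x' = F(x)` in `D`; it is meaningful for `t ∈ lifetime F D x`. -/
def flow {n : ℕ} (F : Rn n → Rn n) (D : Set (Rn n)) (t : ℝ) (x : Rn n) : Rn n :=
  if h : ∃ γ : ℝ → Rn n, ∃ I : Set ℝ, t ∈ I ∧ SolvesOn F D x I γ then h.choose t else x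

/-- The set of times at which the orbit of `x` is in `X`. -/
def visits {n : ℕ} (F : Rn n → Rn n) (D X : Set (Rn n)) (x : Rn n) : Set ℝ :=
  {t | t ∈ lifetime F D x ∧ flow F D t x ∈ X}

/-- `I_x`: the largest interval of times around `0` during which the orbit of `x` stays
in `X`. -/
def sojourn {n : ℕ} (F : Rn n → Rn n) (D X : Set (Rn n)) (x : Rn n) : Set ℝ :=
  (visits F D X x).ordConnectedComponent 0

/-- `X` is invariant: every orbit starting in `X` exists and stays in `X` for all times. -/
def InvariantSet {n : ℕ} (F : Rn n → Rn n) (D X : Set (Rn n)) : Prop :=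
  ∀ x ∈ X, visits F D X x = univ

/-- The Koopman eigenfunction equation `φ(S^τ x) = e^{μτ} φ(x)` for `x ∈ X` and `τ ∈ I_x`,
where each `I_x` is an open interval containing `0`. -/
def EigenEquation {n : ℕ} (F : Rn n → Rn n) (D X : Set (Rn n)) (μ : ℂ) (φ : Rn n → ℂ) : Prop :=
  ∀ x ∈ X, IsOpen (sojourn F D X x) ∧ (0 : ℝ) ∈ sojourn F D X x ∧
    ∀ τ ∈ sojourn F D X x, φ (flow F D τ x) = Complex.exp (μ * (τ : ℂ)) * φ x

/-- Open eigenfunction: the eigenfunction equation on a set that is not invariant. -/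
def IsOpenEigenfunction {n : ℕ} (F : Rn n → Rn n) (D X : Set (Rn n)) (μ : ℂ)
    (φ : Rn n → ℂ) : Prop :=
  X ⊆ D ∧ ¬ InvariantSet F D X ∧ EigenEquation F D X μ φ

/-- Subdomain eigenfunction: the eigenfunction equation on a proper invariant subset. -/
def IsSubdomainEigenfunction {n : ℕ} (F : Rn n → Rn n) (D X : Set (Rn n)) (μ : ℂ)
    (φ : Rn n → ℂ) : Prop :=
  X ⊂ D ∧ InvariantSet F D X ∧ EigenEquation F D X μ φ

/-- Ordinary eigenfunction on the whole state space `D`, for all times. -/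
def IsEigenfunction {n : ℕ} (F : Rn n → Rn n) (D : Set (Rn n)) (μ : ℂ) (φ : Rn n → ℂ) : Prop :=
  ∀ x ∈ D, ∀ τ : ℝ, τ ∈ lifetime F D x ∧
    φ (flow F D τ x) = Complex.exp (μ * (τ : ℂ)) * φ x

/-- The points that are in `A` at some time `t ≥ 0`. -/
def backwardPart {n : ℕ} (F : Rn n → Rn n) (D A : Set (Rn n)) : Set (Rn n) :=
  {z ∈ D | ∃ t ∈ visits F D A z, 0 ≤ t}

/-- The points that were in `A` at some time `t < 0`, but are not in `A` at any time `t ≥ 0`. -/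
def forwardPart {n : ℕ} (F : Rn n → Rn n) (D A : Set (Rn n)) : Set (Rn n) :=
  {z ∈ D | (∃ t ∈ visits F D A z, t < 0) ∧ ¬ ∃ t ∈ visits F D A z, 0 ≤ t}

/-- The domain `P` of the extension. -/
def extDomain {n : ℕ} (F : Rn n → Rn n) (D A : Set (Rn n)) : Set (Rn n) :=
  backwardPart F D A ∪ forwardPart F D A

open Classical in
/-- The entry time `t(z)` into `A`: forward in time if the orbit of `z` meets `A` at some time
`t ≥ 0` (so `t(z) = 0` for `z ∈ A`), and otherwise backward in time. -/
def entryTime {n : ℕ} (F : Rn n → Rn n) (D A : Set (Rn n)) (z : Rn n) : ℝ :=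
  if z ∈ backwardPart F D A then sInf {t | t ∈ visits F D A z ∧ 0 ≤ t}
  else sSup {t | t ∈ visits F D A z ∧ t < 0}

/-- The Jacobian matrix `DF|₀`. -/
def jacobianZero {n : ℕ} (F : Rn n → Rn n) : Matrix (Fin n) (Fin n) ℝ :=
  Matrix.of fun i j => fderiv ℝ F 0 (EuclideanSpace.single j 1) i

/-- `h` is a local linearization of the flow at `0`: a homeomorphism of an open neighbourhood
`h.source ⊆ D` of `0` onto an open neighbourhood `h.target` of `0`, with
`h(S^t x) = e^{tA} h(x)` for all `t` in an open interval around `0` (depending on `x`),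
where `A = DF|₀`. -/
structure IsHartmanLinearization {n : ℕ} (F : Rn n → Rn n) (D : Set (Rn n))
    (h : OpenPartialHomeomorph (Rn n) (Rn n)) : Prop where
  source_subset : h.source ⊆ D
  zero_mem_source : (0 : Rn n) ∈ h.source
  zero_mem_target : (0 : Rn n) ∈ h.target
  conj : ∀ x ∈ h.source, ∃ a b : ℝ, a < 0 ∧ 0 < b ∧ ∀ t ∈ Ioo a b,
    t ∈ visits F D h.source x ∧
      h (flow F D t x) = NormedSpace.exp (t • fderiv ℝ F 0) (h x)

/-- The components of `k = V⁻¹ h`. -/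
def localEigenfunction {n : ℕ} (V : Matrix (Fin n) (Fin n) ℂ) (h : Rn n → Rn n) (j : Fin n)
    (x : Rn n) : ℂ :=
  ∑ i, V⁻¹ j i * ((h x i : ℝ) : ℂ)

end

/-! The heart of the matter is that `e^{-λτ} k(S^τ z)` does not depend on the time `τ` at which the
orbit of `z` is in `A`. Each `k_j` is `h` followed by a row of `V⁻¹`, which is a left eigenvector of
`DF|₀`, so the local conjugacy yields the eigenfunction equation for `k_j` for short times
(`apply_exp_smul_of_apply_eq_mul`, `coordinateFunctional_fderiv`). Hence `τ ↦ e^{-λτ} k(S^τ z)` is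
locally constant on the visiting times. These form an interval because orbits do not return, so it
is constant (`exp_mul_apply_flow_eq`).

The extension is therefore defined with an arbitrary visiting time, and the entry time appears only
as a limit of visiting times. Continuity uses one fixed visiting time for all nearby points, so no
regularity of `t(z)` is needed. The eigenfunction equation is a shift of visiting times. -/

section

/-! ### The maximal local flow: uniqueness, group law, continuous dependence -/

/-- Two solutions of an autonomous `C¹` equation on an interval that agree at one time agree. -/
theorem eqOn_of_hasDerivAt_of_contDiffOn {E : Type*} [NormedAddCommGroup E] [NormedSpace ℝ E]
    {F : E → E} {D : Set E} (hD : IsOpen D) (hF : ContDiffOn ℝ 1 F D) {J : Set ℝ} (hJ : IsOpen J)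
    (hJc : J.OrdConnected) {f g : ℝ → E} (hf : ∀ t ∈ J, f t ∈ D ∧ HasDerivAt f (F (f t)) t)
    (hg : ∀ t ∈ J, g t ∈ D ∧ HasDerivAt g (F (g t)) t) {t₀ : ℝ} (ht₀ : t₀ ∈ J)
    (h₀ : f t₀ = g t₀) : EqOn f g J := by
  intro t ht
  -- The induction needs the implication in both directions for `b` near `a`. If `f a = g a`, local
  -- uniqueness gives agreement nearby; otherwise `f` and `g` differ near `a` and both implications
  -- are vacuous.
  refine hJc.isPreconnected.induction₂' (fun a b => f a = g a → f b = g b) ?_ ?_ ht₀ ht h₀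
  · intro a ha
    refine nhdsWithin_le_nhds ?_
    have hfc := (hf a ha).2.continuousAt
    have hgc := (hg a ha).2.continuousAt
    by_cases hfg : f a = g a
    · obtain ⟨K, s, hs, hl⟩ :=
        (hF.contDiffAt (hD.mem_nhds (hf a ha).1)).exists_lipschitzOnWith
      have hJa := hJ.mem_nhds ha
      have := ODE_solution_unique_of_eventually (v := fun _ => F) (s := fun _ => s) (K := K)
        (t₀ := a) (f := f) (g := g) (Eventually.of_forall fun _ => hl)
        (by filter_upwards [hJa, hfc hs] with b hb hbs using ⟨(hf b hb).2, hbs⟩)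
        (by filter_upwards [hJa, hgc (hfg ▸ hs)] with b hb hbs using ⟨(hg b hb).2, hbs⟩) hfg
      filter_upwards [this] with b hb using ⟨fun _ => hb, fun _ => hfg⟩
    · filter_upwards [(hfc.sub hgc).eventually_ne (sub_ne_zero.2 hfg)] with b hb
      exact ⟨fun h => absurd h hfg, fun h => absurd h (sub_ne_zero.1 hb)⟩
  · exact fun a b c _ _ _ hab hbc h => hbc (hab h)

variable {n : ℕ} {F : Rn n → Rn n} {D A : Set (Rn n)} {x z : Rn n} {I : Set ℝ} {γ : ℝ → Rn n}

namespace SolvesOn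

theorem mem_domain (h : SolvesOn F D x I γ) : x ∈ D := by
  obtain ⟨-, -, h0, rfl, hγ⟩ := h
  exact (hγ 0 h0).1

theorem subset_lifetime (h : SolvesOn F D x I γ) : I ⊆ lifetime F D x :=
  fun _ ht => ⟨I, γ, ht, h⟩

theorem shift (h : SolvesOn F D x I γ) {σ : ℝ} (hσ : σ ∈ I) :
    SolvesOn F D (γ σ) ((· + σ) ⁻¹' I) (fun t => γ (t + σ)) := by
  obtain ⟨hI, hIc, h0, -, hγ⟩ := h
  refine ⟨hI.preimage (by fun_prop), hIc.preimage_mono fun a b hab => by simpa using hab,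
    by simpa using hσ, by simp, fun t ht => ⟨(hγ _ ht).1, (hγ _ ht).2.comp_add_const t σ⟩⟩

theorem flow_eq (h : SolvesOn F D x I γ) (hD : IsOpen D) (hF : ContDiffOn ℝ 1 F D) {t : ℝ}
    (ht : t ∈ I) : flow F D t x = γ t := by
  have hex : ∃ γ : ℝ → Rn n, ∃ I : Set ℝ, t ∈ I ∧ SolvesOn F D x I γ := ⟨γ, I, ht, h⟩
  rw [flow, dif_pos hex]
  obtain ⟨I', ht', hI', hIc', h0', hx', hγ'⟩ := hex.choose_spec
  obtain ⟨hI, hIc, h0, hx, hγ⟩ := h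
  exact eqOn_of_hasDerivAt_of_contDiffOn hD hF (hI'.inter hI) (hIc'.inter hIc)
    (fun s hs => hγ' s hs.1) (fun s hs => hγ s hs.2) ⟨h0', h0⟩ (hx'.trans hx.symm) ⟨ht', ht⟩

end SolvesOn

theorem isOpen_lifetime : IsOpen (lifetime F D x) :=
  isOpen_iff_mem_nhds.2 fun _ ⟨_, _, ht, h⟩ => mem_of_superset (h.1.mem_nhds ht) h.subset_lifetime

theorem ordConnected_lifetime : (lifetime F D x).OrdConnected := by
  have : lifetime F D x = ⋃₀ {I | ∃ γ, SolvesOn F D x I γ} := by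
    ext t
    exact ⟨fun ⟨I, γ, ht, h⟩ => ⟨I, ⟨γ, h⟩, ht⟩, fun ⟨I, ⟨γ, h⟩, ht⟩ => ⟨I, γ, ht, h⟩⟩
  rw [this]
  refine (isPreconnected_sUnion 0 _ ?_ ?_).ordConnected
  · rintro I ⟨γ, h⟩
    exact h.2.2.1
  · rintro I ⟨γ, h⟩
    exact h.2.1.isPreconnected

theorem zero_mem_lifetime {t : ℝ} (ht : t ∈ lifetime F D x) : (0 : ℝ) ∈ lifetime F D x := by
  obtain ⟨I, γ, -, h⟩ := ht
  exact h.subset_lifetime h.2.2.1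

theorem flow_zero (h0 : (0 : ℝ) ∈ lifetime F D x) (hD : IsOpen D) (hF : ContDiffOn ℝ 1 F D) :
    flow F D 0 x = x := by
  obtain ⟨I, γ, h0, h⟩ := h0
  rw [h.flow_eq hD hF h0, h.2.2.2.1]

/-- The flow is the maximal solution. -/
theorem solvesOn_lifetime (h0 : (0 : ℝ) ∈ lifetime F D x) (hD : IsOpen D)
    (hF : ContDiffOn ℝ 1 F D) : SolvesOn F D x (lifetime F D x) (fun t => flow F D t x) := by
  refine ⟨isOpen_lifetime, ordConnected_lifetime, h0, flow_zero h0 hD hF, fun t ht => ?_⟩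
  obtain ⟨I, γ, ht, h⟩ := ht
  have heq : (fun s => flow F D s x) =ᶠ[𝓝 t] γ := by
    filter_upwards [h.1.mem_nhds ht] with s hs using h.flow_eq hD hF hs
  have := h.2.2.2.2 t ht
  exact ⟨by simpa only [heq.eq_of_nhds] using this.1,
    by simpa only [h.flow_eq hD hF ht] using this.2.congr_of_eventuallyEq heq⟩

theorem flow_mem {t : ℝ} (ht : t ∈ lifetime F D x) (hD : IsOpen D) (hF : ContDiffOn ℝ 1 F D) :
    flow F D t x ∈ D :=
  ((solvesOn_lifetime (zero_mem_lifetime ht) hD hF).2.2.2.2 t ht).1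

theorem continuousAt_flow_time {t : ℝ} (ht : t ∈ lifetime F D x) (hD : IsOpen D)
    (hF : ContDiffOn ℝ 1 F D) : ContinuousAt (fun s => flow F D s x) t :=
  ((solvesOn_lifetime (zero_mem_lifetime ht) hD hF).2.2.2.2 t ht).2.continuousAt

theorem solvesOn_flow {σ : ℝ} (hσ : σ ∈ lifetime F D x) (hD : IsOpen D)
    (hF : ContDiffOn ℝ 1 F D) :
    SolvesOn F D (flow F D σ x) ((· + σ) ⁻¹' lifetime F D x) (fun t => flow F D (t + σ) x) :=
  (solvesOn_lifetime (zero_mem_lifetime hσ) hD hF).shift hσ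

theorem flow_flow {σ t : ℝ} (hσ : σ ∈ lifetime F D x) (ht : t + σ ∈ lifetime F D x)
    (hD : IsOpen D) (hF : ContDiffOn ℝ 1 F D) :
    flow F D t (flow F D σ x) = flow F D (t + σ) x :=
  (solvesOn_flow hσ hD hF).flow_eq hD hF ht

/-- Shifting the maximal solution gives one inclusion; the other follows by applying the same shift
from `S^σ x` back to `x` by time `-σ`. -/
theorem mem_lifetime_flow_iff {σ t : ℝ} (hσ : σ ∈ lifetime F D x) (hD : IsOpen D)
    (hF : ContDiffOn ℝ 1 F D) :
    t ∈ lifetime F D (flow F D σ x) ↔ t + σ ∈ lifetime F D x := by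
  refine ⟨fun ht => ?_, fun ht => (solvesOn_flow hσ hD hF).subset_lifetime ht⟩
  have h0 := zero_mem_lifetime hσ
  have hneg : -σ ∈ lifetime F D (flow F D σ x) :=
    (solvesOn_flow hσ hD hF).subset_lifetime (by simpa using h0)
  have hx : flow F D (-σ) (flow F D σ x) = x := by
    rw [flow_flow hσ (by simpa using h0) hD hF, neg_add_cancel, flow_zero h0 hD hF]
  have := (solvesOn_flow hneg hD hF).subset_lifetime (a := t + σ) (by simpa using ht)
  rwa [hx] at this

/-- Around each point, solutions exist on a common time interval and depend continuously on the
initial value. -/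
theorem exists_flow_box (hD : IsOpen D) (hF : ContDiffOn ℝ 1 F D) (hx : x ∈ D) :
    ∃ r > 0, ∃ ε > 0, ∀ t ∈ Ioo (-ε) ε, (∀ y ∈ Metric.ball x r, t ∈ lifetime F D y) ∧
      ContinuousOn (flow F D t) (Metric.ball x r) := by
  obtain ⟨ε, hε, a, r, L, K, hr, hpl⟩ :=
    IsPicardLindelof.of_contDiffAt_one (hF.contDiffAt (hD.mem_nhds hx))
  obtain ⟨α, hα, hc⟩ := (hpl 0).exists_forall_mem_closedBall_eq_hasDerivWithinAt_continuousOn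
  have hr' : (0 : ℝ) < r := hr
  -- A single product ball is chosen on which the Picard–Lindelöf solution `α` is jointly continuous
  -- and also takes values in `D`.
  have hnhds : Metric.closedBall x (r : ℝ) ×ˢ Icc (0 - ε) (0 + ε) ∈ 𝓝 (x, (0 : ℝ)) :=
    prod_mem_nhds (Metric.closedBall_mem_nhds x hr') (Icc_mem_nhds (by linarith) (by linarith))
  have hαx : α (x, 0) = x := (hα x (Metric.mem_closedBall_self hr'.le)).1
  have hmem : ∀ᶠ p in 𝓝 (x, (0 : ℝ)), α p ∈ D :=
    (hc.continuousAt hnhds) (hD.mem_nhds (hαx.symm ▸ hx))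
  obtain ⟨δ, hδ, hball⟩ := Metric.mem_nhds_iff.1 (inter_mem hnhds hmem)
  rw [← ball_prod_same, Real.ball_eq_Ioo, zero_sub, zero_add] at hball
  have hsol : ∀ y ∈ Metric.ball x δ, SolvesOn F D y (Ioo (-δ) δ) (fun t => α (y, t)) := by
    intro y hy
    have hyr := (hball (mk_mem_prod hy (show (0 : ℝ) ∈ Ioo (-δ) δ from ⟨by linarith, hδ⟩))).1.1
    refine ⟨isOpen_Ioo, ordConnected_Ioo, ⟨by linarith, hδ⟩, (hα y hyr).1, fun t ht => ?_⟩
    refine ⟨(hball (mk_mem_prod hy ht)).2, ((hα y hyr).2 t ?_).hasDerivAt ?_⟩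
    · exact (hball (mk_mem_prod hy ht)).1.2
    · exact mem_of_superset (isOpen_Ioo.mem_nhds ht)
        fun s hs => (hball (mk_mem_prod hy hs)).1.2
  refine ⟨δ, hδ, δ, hδ, fun t ht => ⟨fun y hy => (hsol y hy).subset_lifetime ht, ?_⟩⟩
  refine ContinuousOn.congr (f := fun y => α (y, t)) ?_ fun y hy => (hsol y hy).flow_eq hD hF ht
  exact hc.comp (by fun_prop) fun y hy => (hball (mk_mem_prod hy ht)).1

/-- Continuous dependence on the initial value, over the whole lifetime. -/
theorem eventually_mem_lifetime_and_continuousAt_flow (hD : IsOpen D) (hF : ContDiffOn ℝ 1 F D)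
    {t : ℝ} (ht : t ∈ lifetime F D x) :
    (∀ᶠ y in 𝓝 x, t ∈ lifetime F D y) ∧ ContinuousAt (flow F D t) x := by
  have h0 := zero_mem_lifetime ht
  have hsol := solvesOn_lifetime h0 hD hF
  refine ordConnected_lifetime.isPreconnected.induction₂'
    (fun a b => ((∀ᶠ y in 𝓝 x, a ∈ lifetime F D y) ∧ ContinuousAt (flow F D a) x) →
      (∀ᶠ y in 𝓝 x, b ∈ lifetime F D y) ∧ ContinuousAt (flow F D b) x) ?_
    (fun a b c _ _ _ hab hbc h => hbc (hab h)) h0 ht ?_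
  · intro a ha
    obtain ⟨r, hr, ε, hε, hbox⟩ := exists_flow_box hD hF (flow_mem ha hD hF)
    -- Good behaviour passes from time `b` to time `c` by composing with the short-time map
    -- `S^{c-b}`. The box around `S^a x` serves both `a → b` and `b → a`, since `S^b x` lies in it
    -- for `b` near `a`.
    have key : ∀ b ∈ lifetime F D x, ∀ c ∈ lifetime F D x,
        flow F D b x ∈ Metric.ball (flow F D a x) r → c - b ∈ Ioo (-ε) ε →
        ((∀ᶠ y in 𝓝 x, b ∈ lifetime F D y) ∧ ContinuousAt (flow F D b) x) →
        (∀ᶠ y in 𝓝 x, c ∈ lifetime F D y) ∧ ContinuousAt (flow F D c) x := by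
      rintro b hb c hc hbr hcb ⟨hlife, hcont⟩
      have hev : ∀ᶠ y in 𝓝 x, b ∈ lifetime F D y ∧ c ∈ lifetime F D y := by
        filter_upwards [hlife, hcont (Metric.isOpen_ball.mem_nhds hbr)] with y hy hyr
        have := (hbox _ hcb).1 _ hyr
        rw [mem_lifetime_flow_iff hy hD hF, sub_add_cancel] at this
        exact ⟨hy, this⟩
      refine ⟨hev.mono fun y hy => hy.2, ?_⟩
      have h1 := ((hbox _ hcb).2.continuousAt (Metric.isOpen_ball.mem_nhds hbr)).comp
        (f := flow F D b) hcont
      refine h1.congr ?_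
      filter_upwards [hev] with y hy
      rw [Function.comp_apply, flow_flow hy.1 (by simpa using hy.2) hD hF, sub_add_cancel]
    have hra := Metric.mem_ball_self (x := flow F D a x) hr
    filter_upwards [nhdsWithin_le_nhds ((continuousAt_flow_time ha hD hF)
        (Metric.ball_mem_nhds _ hr)), self_mem_nhdsWithin,
      nhdsWithin_le_nhds (Ioo_mem_nhds (show a - ε < a by linarith) (show a < a + ε by linarith))]
      with b hbr hb hab
    exact ⟨key a ha b hb hra ⟨by linarith [hab.1], by linarith [hab.2]⟩,
      key b hb a ha hbr ⟨by linarith [hab.2], by linarith [hab.1]⟩⟩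
  · have hopen : ∀ᶠ y in 𝓝 x, (0 : ℝ) ∈ lifetime F D y := by
      obtain ⟨r, hr, ε, hε, hbox⟩ := exists_flow_box hD hF hsol.mem_domain
      filter_upwards [Metric.ball_mem_nhds x hr] with y hy
      exact (hbox 0 ⟨by linarith, hε⟩).1 y hy
    refine ⟨hopen, continuousAt_id.congr ?_⟩
    filter_upwards [hopen] with y hy using (flow_zero hy hD hF).symm

end

section

/-! ### Left eigenvectors and the linear flow -/

/-- If `ℓ ∘ L = μ ℓ`, then `ℓ ∘ e^{tL} = e^{μt} ℓ`. -/
theorem apply_exp_smul_of_apply_eq_mul {E : Type*} [NormedAddCommGroup E] [NormedSpace ℝ E]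
    [CompleteSpace E] {L : E →L[ℝ] E} {ℓ : E →L[ℝ] ℂ} {μ : ℂ} (hℓ : ∀ v, ℓ (L v) = μ * ℓ v)
    (t : ℝ) (v : E) :
    ℓ (NormedSpace.exp (t • L) v) = Complex.exp (μ * (t : ℂ)) * ℓ v := by
  -- `e^{-μs} ℓ(e^{sL} v)` has zero derivative, so its values at `t` and `0` agree.
  have hd : ∀ s : ℝ, HasDerivAt
      (fun s : ℝ => Complex.exp (-μ * (s : ℂ)) * ℓ (NormedSpace.exp (s • L) v)) 0 s := by
    intro s
    have h1 : HasDerivAt (fun s : ℝ => Complex.exp (-μ * (s : ℂ)))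
        (Complex.exp (-μ * (s : ℂ)) * (-μ * 1)) s :=
      ((Complex.ofRealCLM.hasDerivAt (x := s)).const_mul (-μ)).cexp
    have h2 : HasDerivAt (fun s : ℝ => ℓ (NormedSpace.exp (s • L) v))
        (ℓ ((L * NormedSpace.exp (s • L)) v)) s :=
      ℓ.hasFDerivAt.comp_hasDerivAt s
        ((hasDerivAt_exp_smul_const' L s).clm_apply (hasDerivAt_const s v) |>.congr_deriv (by simp))
    refine (h1.mul h2).congr_deriv ?_
    rw [mul_apply_eq_comp, hℓ]
    ring
  have hc := is_const_of_deriv_eq_zero (fun s => (hd s).differentiableAt) (fun s => (hd s).deriv) t 0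
  simp only [zero_smul, NormedSpace.exp_zero, Complex.ofReal_zero, mul_zero, Complex.exp_zero,
    one_mul, one_apply_eq_self] at hc
  rw [← hc, ← mul_assoc, ← Complex.exp_add, neg_mul, add_neg_cancel, Complex.exp_zero, one_mul]

variable {n : ℕ} {F : Rn n → Rn n} {D A X : Set (Rn n)} {x z : Rn n}

/-- The functional `v ↦ (V⁻¹ v)_j`. -/
noncomputable def coordinateFunctional (V : Matrix (Fin n) (Fin n) ℂ) (j : Fin n) :
    Rn n →L[ℝ] ℂ :=
  ∑ i, V⁻¹ j i • Complex.ofRealCLM.comp (EuclideanSpace.proj i)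

theorem coordinateFunctional_apply (V : Matrix (Fin n) (Fin n) ℂ) (j : Fin n) (v : Rn n) :
    coordinateFunctional V j v = ∑ i, V⁻¹ j i * ((v i : ℝ) : ℂ) := by
  simp [coordinateFunctional]

theorem localEigenfunction_eq (V : Matrix (Fin n) (Fin n) ℂ) (h : Rn n → Rn n) (j : Fin n) :
    localEigenfunction V h j = fun x => coordinateFunctional V j (h x) := by
  ext x
  rw [coordinateFunctional_apply, localEigenfunction]

theorem fderiv_zero_apply (F : Rn n → Rn n) (v : Rn n) (i : Fin n) :
    fderiv ℝ F 0 v i = ∑ k, jacobianZero F i k * v k := by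
  conv_lhs => rw [← (EuclideanSpace.basisFun (Fin n) ℝ).sum_repr v]
  simp [jacobianZero, mul_comm]

theorem coordinateFunctional_fderiv {V : Matrix (Fin n) (Fin n) ℂ} {ev : Fin n → ℂ}
    (hV : IsUnit V.det)
    (hdiag : V⁻¹ * (jacobianZero F).map (fun r : ℝ => (r : ℂ)) * V = Matrix.diagonal ev)
    (j : Fin n) (v : Rn n) :
    coordinateFunctional V j (fderiv ℝ F 0 v) = ev j * coordinateFunctional V j v := by
  have hM : V⁻¹ * (jacobianZero F).map (fun r : ℝ => (r : ℂ)) = Matrix.diagonal ev * V⁻¹ := by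
    rw [← hdiag, Matrix.mul_assoc, Matrix.mul_nonsing_inv _ hV, Matrix.mul_one]
  have hv := congrFun (congrArg (Matrix.mulVec · fun k => ((v k : ℝ) : ℂ)) hM) j
  simp only [← Matrix.mulVec_mulVec, Matrix.mulVec_diagonal] at hv
  rw [coordinateFunctional_apply, coordinateFunctional_apply]
  refine Eq.trans ?_ hv
  simp [Matrix.mulVec, dotProduct, fderiv_zero_apply]

/-! ### Visiting times, entry time and the domain `P` -/

theorem visits_subset_lifetime : visits F D X x ⊆ lifetime F D x := fun _ h => h.1

/-- Removes the forward/backward case distinction: only the entry time depends on it. -/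
theorem mem_extDomain_iff : z ∈ extDomain F D A ↔ (visits F D A z).Nonempty := by
  constructor
  · rintro (⟨-, t, ht, -⟩ | ⟨-, ⟨t, ht, -⟩, -⟩) <;> exact ⟨t, ht⟩
  · rintro ⟨t, ht⟩
    obtain ⟨I, γ, -, hγ⟩ := ht.1
    have hz : z ∈ D := hγ.mem_domain
    by_cases hb : ∃ t ∈ visits F D A z, 0 ≤ t
    · exact Or.inl ⟨hz, hb⟩
    · exact Or.inr ⟨hz, ⟨t, ht, not_le.1 fun h => hb ⟨t, ht, h⟩⟩, hb⟩

theorem extDomain_subset : extDomain F D A ⊆ D := by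
  rintro z (h | h) <;> exact h.1

theorem entryTime_mem_closure_visits (hz : z ∈ extDomain F D A) :
    entryTime F D A z ∈ closure (visits F D A z) := by
  rw [entryTime]
  split_ifs with hb
  · obtain ⟨-, t, ht, h0⟩ := hb
    exact closure_mono (fun _ h => h.1) (csInf_mem_closure ⟨t, ht, h0⟩ ⟨0, fun _ h => h.2⟩)
  · obtain ⟨-, ⟨t, ht, h0⟩, -⟩ := hz.resolve_left hb
    exact closure_mono (fun _ h => h.1) (csSup_mem_closure ⟨t, ht, h0⟩ ⟨0, fun _ h => h.2.le⟩)

theorem entryTime_mem_lifetime (hz : z ∈ extDomain F D A) :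
    entryTime F D A z ∈ lifetime F D z := by
  rw [entryTime]
  split_ifs with hb
  · obtain ⟨-, t, ht, h0⟩ := hb
    refine ordConnected_lifetime.out (zero_mem_lifetime ht.1) ht.1
      ⟨le_csInf ⟨t, ht, h0⟩ fun _ h => h.2, csInf_le ⟨0, fun _ h => h.2⟩ ⟨ht, h0⟩⟩
  · obtain ⟨-, ⟨t, ht, h0⟩, -⟩ := hz.resolve_left hb
    refine ordConnected_lifetime.out ht.1 (zero_mem_lifetime ht.1)
      ⟨le_csSup ⟨0, fun _ h => h.2.le⟩ ⟨ht, h0⟩, csSup_le ⟨t, ht, h0⟩ fun _ h => h.2.le⟩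

theorem mem_visits_flow_iff {σ t : ℝ} (hσ : σ ∈ lifetime F D x) (hD : IsOpen D)
    (hF : ContDiffOn ℝ 1 F D) :
    t ∈ visits F D X (flow F D σ x) ↔ t + σ ∈ visits F D X x := by
  simp only [visits, mem_ofPred_eq, mem_lifetime_flow_iff hσ hD hF]
  exact and_congr_right fun ht => by rw [flow_flow hσ ht hD hF]

/-- Meeting `A` at some time is a property of the whole orbit, not of the starting point. -/
theorem visits_extDomain (hD : IsOpen D) (hF : ContDiffOn ℝ 1 F D) (hz : z ∈ extDomain F D A) :
    visits F D (extDomain F D A) z = lifetime F D z := by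
  refine visits_subset_lifetime.antisymm fun t ht => ⟨ht, ?_⟩
  obtain ⟨τ, hτ⟩ := mem_extDomain_iff.1 hz
  exact mem_extDomain_iff.2
    ⟨τ - t, (mem_visits_flow_iff ht hD hF).2 (by rwa [sub_add_cancel])⟩

theorem sojourn_extDomain (hD : IsOpen D) (hF : ContDiffOn ℝ 1 F D) (hz : z ∈ extDomain F D A) :
    sojourn F D (extDomain F D A) z = lifetime F D z := by
  obtain ⟨t, ht⟩ := mem_extDomain_iff.1 hz
  have : (lifetime F D z).OrdConnected := ordConnected_lifetime
  rw [sojourn, visits_extDomain hD hF hz]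
  exact ordConnectedComponent_subset.antisymm
    (subset_ordConnectedComponent (zero_mem_lifetime ht.1) subset_rfl)

/-! ### Extension along orbits -/

/-- If `k` satisfies the eigenfunction equation locally on `A`, then `e^{-μτ} k(S^τ z)` does not
depend on the time `τ` at which the orbit of `z` is in `A`. -/
theorem exp_mul_apply_flow_eq {k : Rn n → ℂ} {μ : ℂ} (hD : IsOpen D) (hF : ContDiffOn ℝ 1 F D)
    (hk : ∀ x ∈ A, ∀ᶠ t : ℝ in 𝓝 0, k (flow F D t x) = Complex.exp (μ * (t : ℂ)) * k x)
    (hz : (visits F D A z).OrdConnected) {s t : ℝ} (hs : s ∈ visits F D A z)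
    (ht : t ∈ visits F D A z) :
    Complex.exp (-μ * (s : ℂ)) * k (flow F D s z) =
      Complex.exp (-μ * (t : ℂ)) * k (flow F D t z) := by
  refine hz.isPreconnected.induction₂ (fun a b : ℝ => Complex.exp (-μ * (a : ℂ)) * k (flow F D a z)
    = Complex.exp (-μ * (b : ℂ)) * k (flow F D b z)) ?_
    (fun _ _ _ _ _ _ h h' => h.trans h') (fun _ _ _ _ h => h.symm) hs ht
  intro a ha
  have hlim : Tendsto (fun b : ℝ => b - a) (𝓝 a) (𝓝 0) := by
    simpa using (show Continuous fun b : ℝ => b - a by fun_prop).tendsto a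
  filter_upwards [nhdsWithin_le_nhds (hlim.eventually (hk _ ha.2)), self_mem_nhdsWithin]
    with b hb hbv
  rw [flow_flow ha.1 (by simpa using hbv.1) hD hF, sub_add_cancel] at hb
  rw [hb, ← mul_assoc, ← Complex.exp_add]
  push_cast
  ring_nf

open Classical in
/-- The extension of `k` from `A` to the points whose orbit meets `A`. -/
noncomputable def orbitExtension (F : Rn n → Rn n) (D A : Set (Rn n)) (μ : ℂ) (k : Rn n → ℂ)
    (z : Rn n) : ℂ :=
  if h : (visits F D A z).Nonempty then
    Complex.exp (-μ * (h.some : ℂ)) * k (flow F D h.some z) else 0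

section orbitExtension

variable {k : Rn n → ℂ} {μ : ℂ} (hD : IsOpen D) (hF : ContDiffOn ℝ 1 F D)
  (hk : ∀ x ∈ A, ∀ᶠ t : ℝ in 𝓝 0, k (flow F D t x) = Complex.exp (μ * (t : ℂ)) * k x)
  (hA : ∀ z ∈ D, (visits F D A z).OrdConnected)

include hD hF hk hA

theorem orbitExtension_eq {t : ℝ} (ht : t ∈ visits F D A z) :
    orbitExtension F D A μ k z = Complex.exp (-μ * (t : ℂ)) * k (flow F D t z) := by
  have hne : (visits F D A z).Nonempty := ⟨t, ht⟩
  rw [orbitExtension, dif_pos hne]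
  exact exp_mul_apply_flow_eq hD hF hk (hA z (extDomain_subset (mem_extDomain_iff.2 hne)))
    hne.some_mem ht

theorem orbitExtension_flow {τ : ℝ} (hz : z ∈ extDomain F D A) (hτ : τ ∈ lifetime F D z) :
    orbitExtension F D A μ k (flow F D τ z) =
      Complex.exp (μ * (τ : ℂ)) * orbitExtension F D A μ k z := by
  obtain ⟨t, ht⟩ := mem_extDomain_iff.1 hz
  rw [orbitExtension_eq hD hF hk hA ht,
    orbitExtension_eq hD hF hk hA (t := t - τ)
      ((mem_visits_flow_iff hτ hD hF).2 (by rwa [sub_add_cancel])),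
    flow_flow hτ (by simpa using ht.1) hD hF, sub_add_cancel, ← mul_assoc, ← Complex.exp_add]
  push_cast
  ring_nf

/-- At visiting times the expression equals `e^{μ(τ-t₀)}` times the extension at `z`, so the limit
holds even where `k` has no value at `S^{t₀} z`. -/
theorem tendsto_orbitExtension (z : Rn n) (t₀ : ℝ) :
    Tendsto (fun τ : ℝ => Complex.exp (-μ * (t₀ : ℂ)) * k (flow F D τ z))
      (𝓝[visits F D A z] t₀) (𝓝 (orbitExtension F D A μ k z)) := by
  have hc : Continuous fun τ : ℝ => Complex.exp (μ * (τ : ℂ) - μ * (t₀ : ℂ)) *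
      orbitExtension F D A μ k z := by fun_prop
  have hlim := (hc.tendsto t₀).mono_left (nhdsWithin_le_nhds (s := visits F D A z))
  rw [sub_self, Complex.exp_zero, one_mul] at hlim
  refine hlim.congr' ?_
  filter_upwards [self_mem_nhdsWithin] with τ hτ
  rw [orbitExtension_eq hD hF hk hA hτ, ← mul_assoc, ← Complex.exp_add]
  ring_nf

/-- Since `A` is open, a visiting time `t` of `z` is one for all nearby `y` too, so near `z` the
extension is `e^{-μt} k(S^t y)` with `t` fixed. -/
theorem continuousOn_orbitExtension (hAopen : IsOpen A) (hkc : ContinuousOn k A) :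
    ContinuousOn (orbitExtension F D A μ k) (extDomain F D A) := by
  intro z hz
  obtain ⟨t, ht⟩ := mem_extDomain_iff.1 hz
  obtain ⟨hlife, hcont⟩ := eventually_mem_lifetime_and_continuousAt_flow hD hF ht.1
  have hnhds := hAopen.mem_nhds ht.2
  have hc : ContinuousAt (fun y => Complex.exp (-μ * (t : ℂ)) * k (flow F D t y)) z :=
    continuousAt_const.mul ((hkc.continuousAt hnhds).comp (f := flow F D t) hcont)
  refine (hc.congr ?_).continuousWithinAt
  filter_upwards [hlife, hcont hnhds] with y hy hyA
  exact (orbitExtension_eq hD hF hk hA ⟨hy, hyA⟩).symm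

theorem eigenEquation_orbitExtension :
    EigenEquation F D (extDomain F D A) μ (orbitExtension F D A μ k) := by
  intro z hz
  obtain ⟨t, ht⟩ := mem_extDomain_iff.1 hz
  rw [sojourn_extDomain hD hF hz]
  exact ⟨isOpen_lifetime, zero_mem_lifetime ht.1,
    fun τ hτ => orbitExtension_flow hD hF hk hA hz hτ⟩

end orbitExtension

end

/-! ### The main theorem -/

theorem mainTheorem7 {n : ℕ} (D : Set (Rn n)) (hD : IsOpen D) (h0D : (0 : Rn n) ∈ D)
    (F : Rn n → Rn n) (hF : ContDiffOn ℝ 2 F D) (hF0 : F 0 = 0)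
    -- the equilibrium is hyperbolic
    (hhyp : ∀ μ ∈ spectrum ℂ ((jacobianZero F).map (fun r : ℝ => (r : ℂ))), μ.re ≠ 0)
    -- `V` diagonalizes the linearization
    (V : Matrix (Fin n) (Fin n) ℂ) (ev : Fin n → ℂ) (hV : IsUnit V.det)
    (hdiag : V⁻¹ * (jacobianZero F).map (fun r : ℝ => (r : ℂ)) * V = Matrix.diagonal ev)
    (h : OpenPartialHomeomorph (Rn n) (Rn n)) (hh : IsHartmanLinearization F D h)
    (A : Set (Rn n)) (hAopen : IsOpen A) (hAconn : IsConnected A) (h0A : (0 : Rn n) ∈ A)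
    (hAsub : A ⊆ h.source)
    -- no orbit returns to `A` after having left it
    (hA : ∀ z ∈ D, (visits F D A z).OrdConnected) :
    ∃ s : Fin n → Rn n → ℂ, ∀ j : Fin n,
      -- `s(z) = e^{-λ t(z)} k(S^{t(z)} z)`, with `k` at the entry point as a limit along the orbit
      (∀ z ∈ extDomain F D A,
        (𝓝[visits F D A z] (entryTime F D A z)).NeBot ∧
        Tendsto (fun τ : ℝ => Complex.exp (-(ev j) * (entryTime F D A z : ℂ)) *
            localEigenfunction V h j (flow F D τ z))
          (𝓝[visits F D A z] (entryTime F D A z)) (𝓝 (s j z))) ∧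
      -- and literally, if the entry point is in the domain of `k`
      (∀ z ∈ extDomain F D A, flow F D (entryTime F D A z) z ∈ h.source →
        s j z = Complex.exp (-(ev j) * (entryTime F D A z : ℂ)) *
          localEigenfunction V h j (flow F D (entryTime F D A z) z)) ∧
      -- `s` extends `k`
      A ⊆ extDomain F D A ∧ EqOn (s j) (localEigenfunction V h j) A ∧
      ContinuousOn (s j) (extDomain F D A) ∧
      -- the orbit of a point of `P` stays in `P`, and the eigenfunction equation holds along it
      (∀ z ∈ extDomain F D A, sojourn F D (extDomain F D A) z = lifetime F D z) ∧
      EigenEquation F D (extDomain F D A) (ev j) (s j) ∧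
      (¬ InvariantSet F D (extDomain F D A) →
        IsOpenEigenfunction F D (extDomain F D A) (ev j) (s j)) ∧
      (InvariantSet F D (extDomain F D A) → extDomain F D A ≠ D →
        IsSubdomainEigenfunction F D (extDomain F D A) (ev j) (s j)) ∧
      (InvariantSet F D (extDomain F D A) → extDomain F D A = D →
        IsEigenfunction F D (ev j) (s j)) := by
  have hF1 : ContDiffOn ℝ 1 F D := hF.of_le (by norm_num)
  have hloc : ∀ j, ∀ x ∈ A, ∀ᶠ t : ℝ in 𝓝 0, localEigenfunction V h j (flow F D t x) =
      Complex.exp (ev j * (t : ℂ)) * localEigenfunction V h j x := by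
    intro j x hx
    obtain ⟨a, b, ha, hb, hab⟩ := hh.conj x (hAsub hx)
    filter_upwards [Ioo_mem_nhds ha hb] with t ht
    simp only [localEigenfunction_eq]
    rw [(hab t ht).2, apply_exp_smul_of_apply_eq_mul (coordinateFunctional_fderiv hV hdiag j)]
  have hcont : ∀ j, ContinuousOn (localEigenfunction V h j) h.source := by
    intro j
    rw [localEigenfunction_eq]
    exact (coordinateFunctional V j).continuous.comp_continuousOn h.continuousOn
  have hvis0 : ∀ x ∈ A, (0 : ℝ) ∈ visits F D A x := by
    intro x hx
    obtain ⟨a, b, ha, hb, hab⟩ := hh.conj x (hAsub hx)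
    have h0 := (hab 0 ⟨ha, hb⟩).1.1
    exact ⟨h0, (flow_zero h0 hD hF1).symm ▸ hx⟩
  refine ⟨fun j => orbitExtension F D A (ev j) (localEigenfunction V h j), fun j => ?_⟩
  have hneBot : ∀ z ∈ extDomain F D A,
      (𝓝[visits F D A z] (entryTime F D A z)).NeBot := fun z hz =>
    mem_closure_iff_nhdsWithin_neBot.1 (entryTime_mem_closure_visits hz)
  have heig := eigenEquation_orbitExtension hD hF1 (hloc j) hA
  refine ⟨fun z hz => ⟨hneBot z hz, tendsto_orbitExtension hD hF1 (hloc j) hA z _⟩,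
    fun z hz hsrc => ?_, fun x hx => mem_extDomain_iff.2 ⟨0, hvis0 x hx⟩, fun x hx => ?_,
    continuousOn_orbitExtension hD hF1 (hloc j) hA hAopen ((hcont j).mono hAsub),
    fun z hz => sojourn_extDomain hD hF1 hz, heig, fun hinv => ⟨extDomain_subset, hinv, heig⟩,
    fun hinv hne => ⟨extDomain_subset.ssubset_of_ne hne, hinv, heig⟩, fun hinv heq x hx τ => ?_⟩
  · have := hneBot z hz
    -- When the entry point lies in `h.source`, `k` is continuous there, so the limit along visiting
    -- times is also the literal value.
    refine tendsto_nhds_unique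
      (tendsto_orbitExtension hD hF1 (hloc j) hA z (entryTime F D A z)) (Tendsto.mono_left ?_ nhdsWithin_le_nhds)
    exact (((hcont j).continuousAt (h.open_source.mem_nhds hsrc)).comp
      (f := fun τ => flow F D τ z)
      (continuousAt_flow_time (entryTime_mem_lifetime hz) hD hF1)).const_mul _
  · have h0 := hvis0 x hx
    dsimp only
    rw [orbitExtension_eq hD hF1 (hloc j) hA h0, flow_zero h0.1 hD hF1]
    simp
  · have hx' : x ∈ extDomain F D A := heq.symm ▸ hx
    have hτ : τ ∈ lifetime F D x := visits_subset_lifetime (hinv x hx' ▸ mem_univ τ)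
    exact ⟨hτ, orbitExtension_flow hD hF1 (hloc j) hA hx' hτ⟩
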